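/- All spaces are Tychonoff (completely regular and Hausdorff) and all maps are continuous; $C(X)$ denotes the set of continuous real-valued functions on $X$, and $\dim$ denotes Lebesgue covering dimension ($\dim Z\le n$ if every finite functionally open cover of $Z$ has a finite functionally open refinement such that every point lies in at most $n+1$ of its members). A space $X$ is an $AE(0)$-space if, for every space $Z$ with $\dim Z\le 0$ and every subspace $Z_0\subseteq Z$, every map $f\colon Z_0\to X$ such that $\varphi\circ f$ extends to a continuous real-valued function on $Z$ for each $\varphi\in C(X)$ extends to a map $Z\to X$. An $AE(0)$-group is a topological group whose underlying space is an $AE(0)$-space. A subset $A$ of a space $X$ is $C$-embedded in $X$ if every $f\in C(A)$ extends to an element of $C(X)$. The weight of a space is the least cardinality of a base of its topology. Corollary. Let $\tau\ge\omega$ be a cardinal and let $G$ be an $AE(0)$-group of weight $\tau$. Then there are a set $T$ with $|T|=\tau$ and Polish groups $G_t$, $t\in T$, such that $G$ is topologically and algebraically isomorphic to a closed and $C$-embedded subgroup of the product $\prod_{t\in T} G_t$. -/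

import Mathlib

open Topology Cardinal

universe u

/-- A set is functionally open if it is the complement of the zero set of a continuous
real-valued function. -/
def IsFunctionallyOpen {X : Type u} [TopologicalSpace X] (U : Set X) : Prop :=
  ∃ f : C(X, ℝ), U = {x | f x ≠ 0}

/-- Lebesgue (covering) dimension, for Tychonoff spaces: `dim X ≤ n` if every finite functionally
open cover of `X` has a finite functionally open refinement no point of which lies in more
than `n + 1` members. -/
def LebesgueDimLE (X : Type u) [TopologicalSpace X] (n : ℕ) : Prop :=
  ∀ 𝒰 : Set (Set X), 𝒰.Finite → (∀ U ∈ 𝒰, IsFunctionallyOpen U) → ⋃₀ 𝒰 = Set.univ →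
    ∃ 𝒱 : Set (Set X), 𝒱.Finite ∧ (∀ V ∈ 𝒱, IsFunctionallyOpen V) ∧ ⋃₀ 𝒱 = Set.univ ∧
      (∀ V ∈ 𝒱, ∃ U ∈ 𝒰, V ⊆ U) ∧
      ∀ x : X, {V ∈ 𝒱 | x ∈ V}.encard ≤ n + 1

/-- `X` is an absolute extensor in dimension `n`: for every Tychonoff space `Z` with `dim Z ≤ n`
and every subspace `Z₀` of `Z`, each continuous `f : Z₀ → X` such that `φ ∘ f` extends
continuously to `Z` for every `φ ∈ C(X)` has a continuous extension `Z → X`. -/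
def IsAbsoluteExtensor (n : ℕ) (X : Type u) [TopologicalSpace X] : Prop :=
  ∀ (Z : Type u) [TopologicalSpace Z] [T35Space Z], LebesgueDimLE Z n →
    ∀ (Z₀ : Set Z) (f : C(Z₀, X)),
      (∀ φ : C(X, ℝ), ∃ ψ : C(Z, ℝ), ψ.restrict Z₀ = φ.comp f) →
      ∃ F : C(Z, X), F.restrict Z₀ = f

/-- The weight of a space: the least cardinality of a base of its topology. -/
noncomputable def topologicalWeight (X : Type u) [TopologicalSpace X] : Cardinal.{u} :=
  sInf {κ | ∃ ℬ : Set (Set X), TopologicalSpace.IsTopologicalBasis ℬ ∧ #ℬ = κ}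

/-- A subset `A` of `X` is C-embedded if every continuous real-valued function on `A` extends to a
continuous real-valued function on `X`. -/
def IsCEmbedded {X : Type u} [TopologicalSpace X] (A : Set X) : Prop :=
  ∀ f : C(A, ℝ), ∃ g : C(X, ℝ), g.restrict A = f

/-! Write p for the power of an open surjection from a zero-dimensional second countable space onto
ℝ, and view G inside ℝ^C(G). Since p has a zero-dimensional domain, the AE(0) property extends the
map p⁻¹(G) → G to a continuous F on the whole power (`exists_isCanonicalLift`). Continuous real
functions on this power depend on countably many coordinates, so closing off under φ(F z (F w)⁻¹)
puts every φ in a countable saturated family B. The values of a saturated B determine those of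
quotients in G, so the points indistinguishable from 1 form a normal subgroup. Openness of p and the
freedom to change lifts off B embed the quotient as a closed subspace of ℝ^B, which makes it Polish
for countable B. One such B for each of τ functions embedding G gives the diagonal map into the
product. Its range is closed because a union of saturated families is saturated; it is C-embedded
because each function on G factors through countably many of the families, where Tietze's theorem
applies. -/

/-! ### Dependence on countably many coordinates -/

/-- Every countable set is contained in a countable set closed under a countably valued operation on
finite subsets. -/
theorem exists_countable_closed_superset {α : Type*} (h : Finset α → Set α)
    (hh : ∀ s, (h s).Countable) {S : Set α} (hS : S.Countable) :
    ∃ C : Set α, C.Countable ∧ S ⊆ C ∧ ∀ s : Finset α, (s : Set α) ⊆ C → h s ⊆ C := by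
  let step : Set α → Set α := fun D => D ∪ ⋃ s ∈ {s : Finset α | (s : Set α) ⊆ D}, h s
  let D : ℕ → Set α := fun n => step^[n] S
  have hsucc : ∀ n, D (n + 1) = step (D n) := fun n => Function.iterate_succ_apply' step n S
  have hmono : Monotone D := monotone_nat_of_le_succ fun n => by
    rw [hsucc]; exact Set.subset_union_left
  have hcount : ∀ n, (D n).Countable := by
    intro n
    induction n with
    | zero => exact hS
    | succ n ih =>
      rw [hsucc]
      have hfin : {s : Finset α | (s : Set α) ⊆ D n}.Countable :=
        ((Set.countable_ofPred_finite_subset ih).preimage_of_injOn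
          Finset.coe_injective.injOn).mono fun s hs => by
            exact ⟨s.finite_toSet, hs⟩
      exact ih.union (hfin.biUnion fun s _ => hh s)
  refine ⟨⋃ n, D n, Set.countable_iUnion hcount, Set.subset_iUnion D 0, fun s hs => ?_⟩
  obtain ⟨n, hn⟩ := hmono.directed_le.exists_mem_subset_of_finset_subset_biUnion hs
  refine Set.Subset.trans ?_ (Set.subset_iUnion D (n + 1))
  rw [hsucc]
  exact Set.subset_union_of_subset_right (Set.subset_biUnion_of_mem (u := h) (by exact hn)) _

theorem exists_finset_eqOn_imp_mem {ι Y : Type*} [TopologicalSpace Y] {W : Set (ι → Y)}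
    (hW : IsOpen W) {z : ι → Y} (hz : z ∈ W) :
    ∃ s : Finset ι, ∀ w : ι → Y, (∀ i ∈ s, w i = z i) → w ∈ W := by
  obtain ⟨s, u, hu, hsub⟩ := isOpen_pi_iff.1 hW z hz
  exact ⟨s, fun w hw => hsub fun i hi => by rw [hw i hi]; exact (hu i hi).2⟩

/-- A continuous real function on a power of a second countable space depends on countably many
coordinates. -/
theorem Continuous.exists_countable_dependsOn {ι Y : Type*} [TopologicalSpace Y]
    [SecondCountableTopology Y] {f : (ι → Y) → ℝ} (hf : Continuous f) :
    ∃ C : Set ι, C.Countable ∧ DependsOn f C := by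
  classical
  -- `s'` depends only on the countable data `(V, q)` once `s` is fixed; it is empty if no witness
  -- exists.
  have key : ∀ (s : Finset ι) (V : Set (s → Y)) (q : ℚ), ∃ s' : Finset ι,
      (∃ z : ι → Y, s.restrict z ∈ V ∧ f z < q) →
        ∃ z : ι → Y, s.restrict z ∈ V ∧ ∀ w : ι → Y, (∀ i ∈ s', w i = z i) → f w < q := by
    intro s V q
    by_cases hz : ∃ z : ι → Y, s.restrict z ∈ V ∧ f z < q
    · obtain ⟨z, hzV, hzq⟩ := hz
      obtain ⟨s', hs'⟩ := exists_finset_eqOn_imp_mem (isOpen_Iio.preimage hf) (z := z)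
        (show f z < q from hzq)
      exact ⟨s', fun _ => ⟨z, hzV, hs'⟩⟩
    · exact ⟨∅, fun h => absurd h hz⟩
  choose g hg using key
  obtain ⟨C, hC, -, hcl⟩ := exists_countable_closed_superset
    (fun s : Finset ι => ⋃ V ∈ TopologicalSpace.countableBasis (s → Y), ⋃ q : ℚ,
      (g s V q : Set ι))
    (fun s => (TopologicalSpace.countable_countableBasis _).biUnion fun V _ =>
      Set.countable_iUnion fun q => (g s V q).countable_toSet) Set.countable_empty
  have main : ∀ z z' : ι → Y, (∀ i ∈ C, z i = z' i) → ¬ f z < f z' := by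
    intro z z' hzz' hlt
    obtain ⟨q, hq, hq'⟩ := exists_rat_btwn hlt
    obtain ⟨s, u, hu, hsub⟩ := isOpen_pi_iff.1 (isOpen_Ioi.preimage hf) z'
      (show f z' ∈ Set.Ioi (q : ℝ) from hq')
    let r : Finset ι := s.filter (· ∈ C)
    have hr : ∀ i ∈ r, i ∈ s ∧ i ∈ C := fun i hi => Finset.mem_filter.1 hi
    have hop : IsOpen (Set.pi Set.univ fun i : r => u i) :=
      isOpen_set_pi Set.finite_univ fun i _ => (hu i (hr i i.2).1).1
    obtain ⟨V, hVb, hzV, hVu⟩ := (TopologicalSpace.isBasis_countableBasis (r → Y)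
      ).exists_subset_of_mem_open (a := r.restrict z) (fun i _ => by
        have := (hu i (hr i i.2).1).2
        rwa [← hzz' i (hr i i.2).2] at this) hop
    obtain ⟨z₀, hz₀V, hz₀⟩ := hg r V q ⟨z, hzV, hq⟩
    have hgC : (g r V q : Set ι) ⊆ C := fun i hi =>
      hcl r (fun j hj => (hr j hj).2) (Set.mem_biUnion hVb (Set.mem_iUnion.2 ⟨q, hi⟩))
    -- The splice follows the witness `z₀` on `C`, forcing `f w < q`, and `z'` off `C`. On `s ∩ C`
    -- the set `V` keeps it in the neighbourhood of `z'`, forcing `q < f w`.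
    let w : ι → Y := fun i => if i ∈ C then z₀ i else z' i
    have h1 : f w < q := hz₀ w fun i hi => if_pos (hgC hi)
    have h2 : (q : ℝ) < f w := by
      refine hsub (a := w) fun i hi => ?_
      by_cases hiC : i ∈ C
      · have : w i = z₀ i := if_pos hiC
        rw [this]
        exact hVu hz₀V ⟨i, Finset.mem_filter.2 ⟨hi, hiC⟩⟩ trivial
      · have : w i = z' i := if_neg hiC
        rw [this]
        exact (hu i hi).2
    exact lt_asymm h1 h2
  exact ⟨C, hC, fun z z' h => le_antisymm (not_lt.1 (main z' z fun i hi => (h i hi).symm))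
    (not_lt.1 (main z z' h))⟩

/-! ### Zero-dimensionality of powers -/

theorem isFunctionallyOpen_of_isClopen {X : Type u} [TopologicalSpace X] {V : Set X}
    (hV : IsClopen V) : IsFunctionallyOpen V := by
  refine ⟨⟨V.indicator fun _ => 1, hV.continuous_indicator continuous_const⟩, ?_⟩
  ext x
  by_cases hx : x ∈ V <;> simp [hx]

theorem IsFunctionallyOpen.isOpen {X : Type u} [TopologicalSpace X] {U : Set X}
    (hU : IsFunctionallyOpen U) : IsOpen U := by
  obtain ⟨f, rfl⟩ := hU
  exact isOpen_ne.preimage f.continuous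

/-- A finite open cover of a second countable space with a base of clopen sets can be shrunk to a
clopen partition. -/
theorem exists_clopen_partition {X κ : Type*} [TopologicalSpace X] [SecondCountableTopology X]
    (hX : TopologicalSpace.IsTopologicalBasis {V : Set X | IsClopen V})
    {U : κ → Set X} (hU : ∀ k, IsOpen (U k)) (hcov : ∀ x, ∃ k, x ∈ U k) :
    ∃ W : κ → Set X, (∀ k, IsClopen (W k)) ∧ (∀ k, W k ⊆ U k) ∧ ∀ x, ∃! k, x ∈ W k := by
  rcases isEmpty_or_nonempty X with hE | hE
  · exact ⟨fun _ => ∅, fun _ => isClopen_empty, fun _ => Set.empty_subset _, fun x => hE.elim x⟩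
  choose k hk using hcov
  have := fun x => hX.exists_subset_of_mem_open (hk x) (hU (k x))
  choose V hV hxV hVU using this
  obtain ⟨s, hs, hsV⟩ := TopologicalSpace.countable_cover_nhds
    fun x => (hV x).isOpen.mem_nhds (hxV x)
  have hsne : s.Nonempty := by
    by_contra h
    rw [Set.not_nonempty_iff_eq_empty.1 h, Set.biUnion_empty] at hsV
    exact Set.empty_ne_univ hsV
  obtain ⟨e, rfl⟩ := hs.exists_eq_range hsne
  classical
  have hex : ∀ x, ∃ n, x ∈ V (e n) := fun x => by
    have : x ∈ ⋃ y ∈ Set.range e, V y := hsV ▸ Set.mem_univ x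
    simpa using this
  -- The least index of a covering clopen set is locally constant, so any grouping of its level sets
  -- is a clopen partition.
  let m : X → ℕ := fun x => Nat.find (hex x)
  have hm : IsLocallyConstant m := by
    rw [IsLocallyConstant.iff_eventually_eq]
    intro x
    have h1 : ∀ᶠ y in 𝓝 x, y ∈ V (e (m x)) :=
      (hV _).isOpen.mem_nhds (Nat.find_spec (hex x))
    have h2 : ∀ᶠ y in 𝓝 x, ∀ j ∈ Finset.range (m x), y ∉ V (e j) := by
      rw [Filter.eventually_all_finset]
      exact fun j hj => (hV _).compl.isOpen.mem_nhds
        (Nat.find_min (hex x) (Finset.mem_range.1 hj))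
    filter_upwards [h1, h2] with y hy1 hy2
    exact (Nat.find_eq_iff (hex y)).2 ⟨hy1, fun j hj => hy2 j (Finset.mem_range.2 hj)⟩
  refine ⟨fun i => m ⁻¹' {n | k (e n) = i}, fun i => ⟨⟨hm {n | k (e n) = i}ᶜ⟩, hm _⟩, ?_, ?_⟩
  · intro i x hx
    have hx' : k (e (m x)) = i := hx
    exact hx' ▸ hVU _ (Nat.find_spec (hex x))
  · exact fun x => ⟨k (e (m x)), rfl, fun i hi => Eq.symm hi⟩

theorem isTopologicalBasis_clopens_pi {ι Y : Type*} [TopologicalSpace Y]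
    (hY : TopologicalSpace.IsTopologicalBasis {V : Set Y | IsClopen V}) :
    TopologicalSpace.IsTopologicalBasis {V : Set (ι → Y) | IsClopen V} := by
  refine TopologicalSpace.isTopologicalBasis_of_isOpen_of_nhds (fun V hV => hV.isOpen) ?_
  intro z O hz hO
  obtain ⟨s, u, hu, hsub⟩ := isOpen_pi_iff.1 hO z hz
  have : ∀ i, ∃ V : Set Y, IsClopen V ∧ z i ∈ V ∧ (i ∈ s → V ⊆ u i) := by
    intro i
    by_cases hi : i ∈ s
    · obtain ⟨V, hV, hzV, hVu⟩ := hY.exists_subset_of_mem_open (hu i hi).2 (hu i hi).1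
      exact ⟨V, hV, hzV, fun _ => hVu⟩
    · exact ⟨Set.univ, isClopen_univ, trivial, fun h => absurd h hi⟩
  choose V hV hzV hVu using this
  refine ⟨Set.pi s V, ⟨isClosed_set_pi fun i _ => (hV i).isClosed,
    isOpen_set_pi s.finite_toSet fun i _ => (hV i).isOpen⟩, fun i _ => hzV i, ?_⟩
  exact fun w hw => hsub fun i hi => hVu i hi (hw i hi)

theorem isTopologicalBasis_clopens_prod {X Y : Type*} [TopologicalSpace X] [TopologicalSpace Y]
    (hX : TopologicalSpace.IsTopologicalBasis {V : Set X | IsClopen V})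
    (hY : TopologicalSpace.IsTopologicalBasis {V : Set Y | IsClopen V}) :
    TopologicalSpace.IsTopologicalBasis {V : Set (X × Y) | IsClopen V} := by
  refine TopologicalSpace.isTopologicalBasis_of_isOpen_of_nhds (fun V hV => hV.isOpen) ?_
  intro z O hz hO
  obtain ⟨V, ⟨A, hA, B, hB, rfl⟩, hzV, hV⟩ := (hX.prod hY).exists_subset_of_mem_open hz hO
  exact ⟨A ×ˢ B, hA.prod hB, hzV, hV⟩

/-- A finite functionally open cover depends on a countable set of coordinates, so a clopen
partition of the second countable power over that set can be pulled back. -/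
theorem lebesgueDimLE_zero_pi {ι : Type u} {Y : Type} [TopologicalSpace Y]
    [SecondCountableTopology Y] [Nonempty Y] (hY : TopologicalSpace.IsTopologicalBasis {V : Set Y | IsClopen V}) :
    LebesgueDimLE (ι → Y) 0 := by
  intro 𝒰 hfin hopen hcov
  have : ∀ U : 𝒰, ∃ C : Set ι, C.Countable ∧ DependsOn (· ∈ U.1) C := by
    rintro ⟨U, hU⟩
    obtain ⟨f, rfl⟩ := hopen U hU
    obtain ⟨C, hC, hdep⟩ := f.continuous.exists_countable_dependsOn
    exact ⟨C, hC, fun z w h => by simp [hdep h]⟩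
  choose D hD hdep using this
  have := hfin.to_subtype
  let C := ⋃ U, D U
  have hC : Countable C := (Set.countable_iUnion hD).to_subtype
  have hUC : ∀ U : 𝒰, DependsOn (· ∈ U.1) C := fun U z w h =>
    hdep U fun i hi => h i (Set.mem_iUnion_of_mem U hi)
  classical
  obtain ⟨y₀⟩ := ‹Nonempty Y›
  let ext : (C → Y) → ι → Y := fun v i => if h : i ∈ C then v ⟨i, h⟩ else y₀
  have hext : Continuous ext := continuous_pi fun i => by
    by_cases h : i ∈ C
    · simpa [ext, h] using continuous_apply _
    · simpa [ext, h] using continuous_const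
  have hr : ∀ (U : 𝒰) z, ext (C.domRestrict z) ∈ U.1 ↔ z ∈ U.1 := fun U z =>
    iff_of_eq (hUC U fun i hi => by simp [ext, hi, Set.domRestrict])
  obtain ⟨W, hW, hWU, huniq⟩ := exists_clopen_partition (isTopologicalBasis_clopens_pi (ι := C) hY)
    (U := fun U : 𝒰 => ext ⁻¹' U.1) (fun U => (hopen U U.2).isOpen.preimage hext) (fun v => by
      obtain ⟨U, hU, hv⟩ := hcov.symm ▸ Set.mem_univ (ext v)
      exact ⟨⟨U, hU⟩, hv⟩)
  refine ⟨Set.range fun U => C.domRestrict ⁻¹' W U, Set.finite_range _, ?_, ?_, ?_, ?_⟩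
  · rintro _ ⟨U, rfl⟩
    exact isFunctionallyOpen_of_isClopen
      ((hW U).preimage (continuous_pi fun i => continuous_apply i.1))
  · refine Set.eq_univ_of_forall fun z => ?_
    obtain ⟨U, hU, -⟩ := huniq (C.domRestrict z)
    exact ⟨_, ⟨U, rfl⟩, hU⟩
  · rintro _ ⟨U, rfl⟩
    exact ⟨U, U.2, fun z hz => (hr U z).1 (hWU U hz)⟩
  · intro z
    rw [Nat.cast_zero, zero_add, Set.encard_le_one_iff]
    rintro _ _ ⟨⟨U, rfl⟩, hU⟩ ⟨⟨U', rfl⟩, hU'⟩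
    rw [(huniq _).unique hU hU']

/-! ### An open map from pairs of irrationals onto the line -/

theorem isTopologicalBasis_clopens_irrational :
    TopologicalSpace.IsTopologicalBasis {V : Set {x : ℝ // Irrational x} | IsClopen V} := by
  refine TopologicalSpace.isTopologicalBasis_of_isOpen_of_nhds (fun V hV => hV.isOpen) ?_
  rintro x O hx hO
  obtain ⟨O', hO', rfl⟩ := isOpen_induced_iff.1 hO
  obtain ⟨ε, hε, hsub⟩ := Metric.isOpen_iff.1 hO' x.1 hx
  obtain ⟨a, ha, hax⟩ := exists_rat_btwn (sub_lt_self x.1 hε)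
  obtain ⟨b, hxb, hb⟩ := exists_rat_btwn (lt_add_of_pos_right x.1 hε)
  refine ⟨Subtype.val ⁻¹' Set.Ioo (a : ℝ) b, ⟨?_, isOpen_Ioo.preimage continuous_subtype_val⟩,
    ⟨hax, hxb⟩, fun y hy => hsub ?_⟩
  · convert (isClosed_Icc (a := (a : ℝ)) (b := b)).preimage continuous_subtype_val using 1
    ext y
    exact ⟨fun h => ⟨h.1.le, h.2.le⟩, fun h => ⟨h.1.lt_of_ne fun e => y.2 ⟨a, e⟩,
      h.2.lt_of_ne fun e => y.2 ⟨b, e.symm⟩⟩⟩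
  · rw [Metric.mem_ball, Real.dist_eq, abs_lt]
    constructor <;> linarith [hy.1, hy.2]

/-- The square of the space of irrational numbers: a zero-dimensional second countable space which
is mapped onto the real line by an open map. -/
abbrev IrrationalPair : Type := {x : ℝ // Irrational x} × {x : ℝ // Irrational x}

/-- Addition of two irrational numbers. -/
def irrationalSum (y : IrrationalPair) : ℝ := y.1.1 + y.2.1

theorem continuous_irrationalSum : Continuous irrationalSum := by
  unfold irrationalSum; fun_prop

theorem exists_irrational_sub_irrational (x : ℝ) {O : Set ℝ} (hO : IsOpen O) (hne : O.Nonempty) :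
    ∃ a ∈ O, Irrational a ∧ Irrational (x - a) := by
  have hc : ((Set.range ((↑) : ℚ → ℝ)) ∪ (fun a => x - a) '' Set.range ((↑) : ℚ → ℝ)).Countable :=
    (Set.countable_range _).union ((Set.countable_range _).image _)
  obtain ⟨a, haO, ha⟩ := (hc.dense_compl ℝ).exists_mem_open hO hne |>.imp fun a h => h.symm
  exact ⟨a, haO, fun h => ha (Or.inl h), fun h => ha (Or.inr ⟨x - a, h, by ring⟩)⟩

theorem surjective_irrationalSum : Function.Surjective irrationalSum := fun x => by
  obtain ⟨a, -, ha, hxa⟩ := exists_irrational_sub_irrational x isOpen_univ Set.univ_nonempty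
  exact ⟨(⟨a, ha⟩, ⟨x - a, hxa⟩), by simp [irrationalSum]⟩

/-- For x near a + b, an irrational c close to both a and x - b, with x - c irrational, gives the
nearby preimage (c, x - c). -/
theorem isOpenMap_irrationalSum : IsOpenMap irrationalSum := by
  rw [isOpenMap_iff_nhds_le]
  rintro ⟨a, b⟩ S hS
  rw [Filter.mem_map, nhds_prod_eq, nhds_subtype_eq_comap, nhds_subtype_eq_comap,
    Filter.mem_prod_iff] at hS
  obtain ⟨_, ⟨A, hA, hA'⟩, _, ⟨B, hB, hB'⟩, hsub⟩ := hS
  obtain ⟨ε, hε, hAε⟩ := Metric.mem_nhds_iff.1 hA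
  obtain ⟨δ, hδ, hBδ⟩ := Metric.mem_nhds_iff.1 hB
  let η := min ε δ
  have hη : 0 < η := lt_min hε hδ
  refine Metric.mem_nhds_iff.2 ⟨η, hη, fun x hx => ?_⟩
  rw [Metric.mem_ball, Real.dist_eq, abs_lt, irrationalSum] at hx
  obtain ⟨c, ⟨⟨h1, h2⟩, h3, h4⟩, hc, hxc⟩ := exists_irrational_sub_irrational x
    ((isOpen_Ioo (a := a.1 - η) (b := a.1 + η)).inter
      (isOpen_Ioo (a := x - b.1 - η) (b := x - b.1 + η)))
    (by
      refine ⟨(a.1 + (x - b.1)) / 2, ⟨?_, ?_⟩, ?_, ?_⟩ <;> dsimp at hx <;> linarith [hx.1, hx.2])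
  have hηε : η ≤ ε := min_le_left _ _
  have hηδ : η ≤ δ := min_le_right _ _
  have : ((⟨c, hc⟩, ⟨x - c, hxc⟩) : IrrationalPair) ∈ irrationalSum ⁻¹' S := by
    refine hsub ⟨hA' (hAε ?_), hB' (hBδ ?_)⟩ <;>
    · rw [Metric.mem_ball, Real.dist_eq, abs_lt]
      constructor <;> dsimp <;> linarith
  simpa [irrationalSum] using this

/-! ### Lifting along the embedding into a power of the line -/

/-- Evaluation of points at the functions of a family `B`. -/
def evalOn {X : Type u} [TopologicalSpace X] (B : Set C(X, ℝ)) (x : X) : B → ℝ := fun φ => φ.1 x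

theorem continuous_evalOn {X : Type u} [TopologicalSpace X] (B : Set C(X, ℝ)) :
    Continuous (evalOn B) := continuous_pi fun φ => φ.1.continuous

theorem T35Space.exists_continuousMap {X : Type u} [TopologicalSpace X] [T35Space X] {x : X}
    {O : Set X} (hO : IsOpen O) (hx : x ∈ O) : ∃ φ : C(X, ℝ), φ x = 0 ∧ ∀ y ∉ O, φ y = 1 := by
  obtain ⟨f, hf, h0, h1⟩ := CompletelyRegularSpace.completely_regular_isOpen x O hO hx
  exact ⟨⟨fun y => f y, continuous_subtype_val.comp hf⟩, by simp [h0], fun y hy => by simp [h1 hy]⟩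

/-- A family of real functions that separates points from the complements of their neighbourhoods
embeds the space into a power of the real line. -/
theorem isEmbedding_evalOn {X : Type u} [TopologicalSpace X] [T0Space X] {B : Set C(X, ℝ)}
    (hB : ∀ (x : X) (O : Set X), IsOpen O → x ∈ O →
      ∃ φ ∈ B, ∃ V : Set ℝ, V ∈ 𝓝 (φ x) ∧ φ ⁻¹' V ⊆ O) : IsEmbedding (evalOn B) := by
  have : IsInducing (evalOn B) := by
    rw [isInducing_iff_nhds]
    refine fun x => le_antisymm (Filter.map_le_iff_le_comap.1
      (continuous_evalOn B).continuousAt) fun S hS => ?_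
    obtain ⟨O, hOS, hO, hx⟩ := mem_nhds_iff.1 hS
    obtain ⟨φ, hφ, V, hV, hVO⟩ := hB x O hO hx
    exact ⟨(fun v : B → ℝ => v ⟨φ, hφ⟩) ⁻¹' V,
      (continuous_apply (⟨φ, hφ⟩ : B)).continuousAt.preimage_mem_nhds hV,
      fun y hy => hOS (hVO hy)⟩
  exact this.isEmbedding

/-- A map from a power of `IrrationalPair` that inverts the canonical embedding of `X` into the
power of the real line indexed by all real functions on `X`. -/
def IsCanonicalLift {X : Type u} [TopologicalSpace X] (F : (C(X, ℝ) → IrrationalPair) → X) : Prop :=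
  ∀ z x, (∀ φ, irrationalSum (z φ) = φ x) → F z = x

/-- On the preimage of X the composite with φ is the sum of the φ-th pair, which is defined on the
whole power; hence the extension condition holds. -/
theorem IsAbsoluteExtensor.exists_isCanonicalLift {X : Type u} [TopologicalSpace X] [T35Space X]
    (hX : IsAbsoluteExtensor 0 X) :
    ∃ F : C(C(X, ℝ) → IrrationalPair, X), IsCanonicalLift F := by
  have hemb : IsEmbedding (evalOn (Set.univ : Set C(X, ℝ))) :=
    isEmbedding_evalOn fun x O hO hx => by
      obtain ⟨φ, h0, h1⟩ := T35Space.exists_continuousMap hO hx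
      refine ⟨φ, trivial, Set.Iio 1, Iio_mem_nhds (by simp [h0]), fun y hy => ?_⟩
      by_contra hyO
      simp [h1 y hyO] at hy
  let Z := C(X, ℝ) → IrrationalPair
  let p : Z → ↥(Set.univ : Set C(X, ℝ)) → ℝ := fun z φ => irrationalSum (z φ.1)
  have hp : Continuous p :=
    continuous_pi fun φ => continuous_irrationalSum.comp (continuous_apply φ.1)
  let Z₀ : Set Z := {z | p z ∈ Set.range (evalOn Set.univ)}
  let f : C(Z₀, X) := ⟨fun z => hemb.toHomeomorph.symm ⟨p z, z.2⟩,
    hemb.toHomeomorph.symm.continuous.comp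
      ((hp.comp continuous_subtype_val).subtype_mk fun z => z.2)⟩
  have hf : ∀ z : Z₀, evalOn Set.univ (f z) = p z := fun z =>
    congrArg Subtype.val (hemb.toHomeomorph.apply_symm_apply ⟨p z, z.2⟩)
  have : Nonempty IrrationalPair := ⟨(surjective_irrationalSum 0).choose⟩
  obtain ⟨F, hF⟩ := hX Z (lebesgueDimLE_zero_pi (isTopologicalBasis_clopens_prod
    isTopologicalBasis_clopens_irrational isTopologicalBasis_clopens_irrational)) Z₀ f fun φ => by
      refine ⟨⟨fun z => irrationalSum (z φ), continuous_irrationalSum.comp (continuous_apply φ)⟩, ?_⟩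
      ext z
      exact (congrFun (hf z) ⟨φ, trivial⟩).symm
  refine ⟨F, fun z x hzx => ?_⟩
  have hpz : evalOn Set.univ x = p z := funext fun φ => (hzx φ.1).symm
  have hz : z ∈ Z₀ := ⟨x, hpz⟩
  have h1 : F z = f ⟨z, hz⟩ := DFunLike.congr_fun hF ⟨z, hz⟩
  rw [h1]
  exact hemb.injective ((hf ⟨z, hz⟩).trans hpz.symm)

theorem exists_irrationalSum_eq_and_eqOn {ι : Type*} (v : ι → ℝ) (z : ι → IrrationalPair) {B : Set ι}
    (h : ∀ i ∈ B, irrationalSum (z i) = v i) :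
    ∃ w : ι → IrrationalPair, (∀ i, irrationalSum (w i) = v i) ∧ ∀ i ∈ B, w i = z i := by
  classical
  choose s hs using surjective_irrationalSum
  refine ⟨fun i => if i ∈ B then z i else s (v i), fun i => ?_, fun i hi => if_pos hi⟩
  by_cases hi : i ∈ B
  · simp [hi, h]
  · simp [hi, hs]

/-- A product of open surjections followed by a projection; surjectivity handles the infinitely many
unrestricted coordinates. -/
theorem isOpenMap_irrationalSum_pi {ι : Type*} (B : Set ι) :
    IsOpenMap fun (z : ι → IrrationalPair) (i : B) => irrationalSum (z i) := by
  have h1 : IsOpenMap (Pi.map fun _ : ι => irrationalSum) :=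
    IsOpenMap.piMap (fun _ => isOpenMap_irrationalSum)
      (Filter.Eventually.of_forall fun _ => surjective_irrationalSum)
  have h2 : IsOpenMap fun (v : ι → ℝ) (i : B) => v i := by
    rw [isOpenMap_iff_nhds_le]
    intro v S hS
    rw [Filter.mem_map, nhds_pi, Filter.mem_pi'] at hS
    obtain ⟨I, t, ht, hsub⟩ := hS
    classical
    have : Set.pi (((↑) : B → ι) ⁻¹' (I : Set ι)) (fun i => t i) ∈ 𝓝 fun i : B => v i :=
      set_pi_mem_nhds (I.finite_toSet.preimage Subtype.val_injective.injOn) fun i _ => ht i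
    refine Filter.mem_of_superset this fun w hw => ?_
    let w' : ι → ℝ := fun i => if h : i ∈ B then w ⟨i, h⟩ else v i
    have hw' : w' ∈ Set.pi (I : Set ι) t := fun i hi => by
      by_cases h : i ∈ B
      · simpa [w', h] using hw ⟨i, h⟩ hi
      · simpa [w', h] using mem_of_mem_nhds (ht i)
    have := hsub hw'
    simpa [w'] using this
  exact h2.comp h1

theorem IsCanonicalLift.exists_eq {X : Type u} [TopologicalSpace X]
    {F : (C(X, ℝ) → IrrationalPair) → X} (hl : IsCanonicalLift F) (x : X) :
    ∃ z, (∀ φ, irrationalSum (z φ) = φ x) ∧ F z = x := by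
  choose s hs using surjective_irrationalSum
  exact ⟨fun φ => s (φ x), fun φ => hs _, hl _ _ fun φ => hs _⟩

theorem IsCanonicalLift.exists_eq_of_agree {X : Type u} [TopologicalSpace X]
    {F : (C(X, ℝ) → IrrationalPair) → X} {B : Set C(X, ℝ)} (hl : IsCanonicalLift F)
    {z : C(X, ℝ) → IrrationalPair} {x : X} (h : ∀ φ ∈ B, irrationalSum (z φ) = φ x) : ∃ w, (∀ φ ∈ B, w φ = z φ) ∧ F w = x := by
  obtain ⟨w, hw, hwz⟩ := exists_irrationalSum_eq_and_eqOn (fun φ : C(X, ℝ) => φ x) z h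
  exact ⟨w, hwz, hl _ _ hw⟩

theorem IsCanonicalLift.exists_agree {X : Type u} [TopologicalSpace X]
    {F : (C(X, ℝ) → IrrationalPair) → X} {B : Set C(X, ℝ)} (hl : IsCanonicalLift F) {x y : X}
    (h : evalOn B x = evalOn B y) : ∃ z w, F z = x ∧ F w = y ∧ ∀ φ ∈ B, z φ = w φ := by
  obtain ⟨z, hz, hzx⟩ := hl.exists_eq x
  obtain ⟨w, hwz, hwy⟩ := hl.exists_eq_of_agree (B := B) (z := z) (x := y)
    fun φ hφ => (hz φ).trans (congrFun h ⟨φ, hφ⟩)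
  exact ⟨z, w, hzx, hwy, fun φ hφ => (hwz φ hφ).symm⟩

/-! ### Saturated families and their quotient groups -/

section Spectrum

variable {G : Type u} [Group G] [TopologicalSpace G]

/-- A family `B` of real functions on `G` is saturated with respect to `F` if the composition of a
member of `B` with division in `G` depends, after lifting along `F`, on the coordinates in `B`
only. -/
def IsSaturated (F : (C(G, ℝ) → IrrationalPair) → G) (B : Set C(G, ℝ)) : Prop :=
  ∀ φ ∈ B, ∀ ⦃z z' w w' : C(G, ℝ) → IrrationalPair⦄, (∀ ψ ∈ B, z ψ = z' ψ) →
    (∀ ψ ∈ B, w ψ = w' ψ) → φ (F z * (F w)⁻¹) = φ (F z' * (F w')⁻¹)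

variable {F : (C(G, ℝ) → IrrationalPair) → G} {B : Set C(G, ℝ)}

theorem isSaturated_iUnion {κ : Type*} {B : κ → Set C(G, ℝ)} (hB : ∀ k, IsSaturated F (B k)) :
    IsSaturated F (⋃ k, B k) := by
  intro φ hφ z z' w w' hz hw
  obtain ⟨k, hk⟩ := Set.mem_iUnion.1 hφ
  exact hB k φ hk (fun ψ h => hz ψ (Set.mem_iUnion_of_mem k h))
    fun ψ h => hw ψ (Set.mem_iUnion_of_mem k h)

theorem exists_countable_isSaturated [IsTopologicalGroup G] (hF : Continuous F) (φ : C(G, ℝ)) :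
    ∃ B : Set C(G, ℝ), B.Countable ∧ φ ∈ B ∧ IsSaturated F B := by
  have key : ∀ φ : C(G, ℝ), ∃ C : Set C(G, ℝ), C.Countable ∧ DependsOn
      (fun z : C(G, ℝ) → IrrationalPair × IrrationalPair =>
        φ (F (fun ψ => (z ψ).1) * (F fun ψ => (z ψ).2)⁻¹)) C := fun φ =>
    Continuous.exists_countable_dependsOn (by fun_prop)
  choose c hc hdep using key
  obtain ⟨B, hB, hφB, hcl⟩ := exists_countable_closed_superset (fun s => ⋃ ψ ∈ s, c ψ)
    (fun s => s.countable_toSet.biUnion fun ψ _ => hc ψ) (Set.countable_singleton φ)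
  refine ⟨B, hB, hφB rfl, fun ψ hψ z z' w w' hz hw => ?_⟩
  have hsub : c ψ ⊆ B := by simpa using hcl {ψ} (by simpa using hψ)
  exact hdep ψ (x := fun χ => (z χ, w χ)) (y := fun χ => (z' χ, w' χ)) fun χ hχ =>
    Prod.ext (hz χ (hsub hχ)) (hw χ (hsub hχ))

/-- Saturation is applied with a fixed lift of 1 as divisor. -/
theorem IsSaturated.evalOn_lift_eq (hB : IsSaturated F B) (hl : IsCanonicalLift F)
    {z w : C(G, ℝ) → IrrationalPair} (h : ∀ φ ∈ B, z φ = w φ) :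
    evalOn B (F z) = evalOn B (F w) := by
  obtain ⟨e, -, he⟩ := hl.exists_eq (1 : G)
  funext φ
  simpa [he, evalOn] using hB φ.1 φ.2 h fun ψ _ => rfl (a := e ψ)

theorem IsSaturated.evalOn_div_congr (hB : IsSaturated F B) (hl : IsCanonicalLift F)
    {x x' y y' : G} (hx : evalOn B x = evalOn B x') (hy : evalOn B y = evalOn B y') :
    evalOn B (x * y⁻¹) = evalOn B (x' * y'⁻¹) := by
  obtain ⟨z, z', rfl, rfl, hz⟩ := hl.exists_agree hx
  obtain ⟨w, w', rfl, rfl, hw⟩ := hl.exists_agree hy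
  exact funext fun φ => hB φ.1 φ.2 hz hw

theorem IsSaturated.evalOn_mul_congr (hB : IsSaturated F B) (hl : IsCanonicalLift F)
    {x x' y y' : G} (hx : evalOn B x = evalOn B x') (hy : evalOn B y = evalOn B y') :
    evalOn B (x * y) = evalOn B (x' * y') := by
  have := hB.evalOn_div_congr hl hx (hB.evalOn_div_congr hl (rfl (a := evalOn B 1)) hy)
  simpa using this

/-- The normal subgroup of the points that a saturated family does not distinguish from `1`. -/
def IsSaturated.kernel (hB : IsSaturated F B) (hl : IsCanonicalLift F) : Subgroup G where
  carrier := {x | evalOn B x = evalOn B 1}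
  one_mem' := rfl
  mul_mem' hx hy := by simpa using hB.evalOn_mul_congr hl hx hy
  inv_mem' {x} hx := by
    have hx' : evalOn B x = evalOn B 1 := hx
    simpa using hB.evalOn_div_congr hl (rfl (a := evalOn B 1)) hx'

theorem IsSaturated.mem_kernel (hB : IsSaturated F B) (hl : IsCanonicalLift F) {x : G} :
    x ∈ hB.kernel hl ↔ evalOn B x = evalOn B 1 := Iff.rfl

instance IsSaturated.normal_kernel (hB : IsSaturated F B) (hl : IsCanonicalLift F) :
    (hB.kernel hl).Normal := ⟨fun x hx g => by
  have hx' : evalOn B x = evalOn B 1 := hx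
  simpa [mem_kernel] using hB.evalOn_div_congr hl
    (hB.evalOn_mul_congr hl (rfl (a := evalOn B g)) hx') (rfl (a := evalOn B g))⟩

theorem IsSaturated.mk_eq_mk_iff (hB : IsSaturated F B) (hl : IsCanonicalLift F) {x y : G} :
    (x : G ⧸ hB.kernel hl) = y ↔ evalOn B x = evalOn B y := by
  rw [QuotientGroup.eq, hB.mem_kernel]
  constructor
  · intro h
    simpa using (hB.evalOn_mul_congr hl (rfl (a := evalOn B x)) h).symm
  · intro h
    simpa using (hB.evalOn_mul_congr hl (rfl (a := evalOn B x⁻¹)) h).symm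

/-- A saturated family maps `G` onto a closed subset of the power of the real line. -/
theorem IsSaturated.isClosed_range_evalOn (hB : IsSaturated F B) (hl : IsCanonicalLift F)
    (hF : Continuous F) : IsClosed (Set.range (evalOn B)) := by
  classical
  refine isClosed_of_closure_subset fun v hv => ?_
  obtain ⟨z, hz, -⟩ := exists_irrationalSum_eq_and_eqOn
    (fun φ => if h : φ ∈ B then v ⟨φ, h⟩ else 0) (fun _ => (surjective_irrationalSum 0).choose)
    (B := ∅) (by simp)
  refine ⟨F z, funext fun φ => ?_⟩
  have hzφ : irrationalSum (z φ) = v φ := by simpa using hz φ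
  rw [← hzφ]
  by_contra hne
  -- If `O` contained `z`, its open image would meet the range at some `x`. Changing `w ∈ O` off `B`
  -- to a lift of `x` preserves the values of `B` at `F w`, contradicting `w ∈ O`.
  let O : Set (C(G, ℝ) → IrrationalPair) := {w | φ.1 (F w) ≠ irrationalSum (w φ)}
  have hO : IsOpen O := isOpen_ne_fun (φ.1.continuous.comp hF)
    (continuous_irrationalSum.comp (continuous_apply φ.1))
  obtain ⟨_, ⟨w, hw, rfl⟩, x, hx⟩ := mem_closure_iff.1 hv _ (isOpenMap_irrationalSum_pi B O hO)
    ⟨z, hne, funext fun ψ => by simpa using hz ψ⟩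
  obtain ⟨w', hw', rfl⟩ := hl.exists_eq_of_agree (B := B) (z := w) (x := x)
    fun ψ hψ => (congrFun hx ⟨ψ, hψ⟩).symm
  exact hw (((congrFun (hB.evalOn_lift_eq hl hw') φ).symm).trans (congrFun hx φ))

/-- A saturated family maps `G` openly onto its image. -/
theorem IsSaturated.exists_isOpen_image_evalOn (hB : IsSaturated F B) (hl : IsCanonicalLift F)
    (hF : Continuous F) {U : Set G} (hU : IsOpen U) :
    ∃ O : Set (B → ℝ), IsOpen O ∧ evalOn B ⁻¹' O = evalOn B ⁻¹' (evalOn B '' U) := by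
  -- The open set is the image of `F ⁻¹' U` in the power over `B`.
  refine ⟨_, isOpenMap_irrationalSum_pi B _ (hU.preimage hF), Set.Subset.antisymm ?_ ?_⟩
  · rintro y ⟨w, hw, hwy⟩
    obtain ⟨w', hw', rfl⟩ := hl.exists_eq_of_agree (B := B) (z := w) (x := y)
      fun ψ hψ => congrFun hwy ⟨ψ, hψ⟩
    exact ⟨F w, hw, (hB.evalOn_lift_eq hl hw').symm⟩
  · rintro y ⟨x, hx, hxy⟩
    obtain ⟨z, hz, rfl⟩ := hl.exists_eq x
    exact ⟨z, hx, (funext fun ψ : B => hz ψ.1 : _ = evalOn B (F z)).trans hxy⟩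

/-- The map induced by a saturated family on the quotient group. -/
def IsSaturated.quotientEval (hB : IsSaturated F B) (hl : IsCanonicalLift F) :
    G ⧸ hB.kernel hl → B → ℝ :=
  fun q => Quotient.liftOn' q (evalOn B) fun _ _ h =>
    (hB.mk_eq_mk_iff hl).1 (Quotient.sound' h)

theorem IsSaturated.isClosedEmbedding_quotientEval (hB : IsSaturated F B) (hl : IsCanonicalLift F)
    (hF : Continuous F) : IsClosedEmbedding (hB.quotientEval hl) := by
  have hcont : Continuous (hB.quotientEval hl) :=
    (QuotientGroup.isQuotientMap_mk _).continuous_iff.2 (continuous_evalOn B)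
  have hinj : Function.Injective (hB.quotientEval hl) := by
    intro p q
    induction p using QuotientGroup.induction_on with | H x => ?_
    induction q using QuotientGroup.induction_on with | H y => ?_
    exact (hB.mk_eq_mk_iff hl).2
  refine ⟨⟨⟨le_antisymm hcont.le_induced fun U hU => ?_⟩, hinj⟩, ?_⟩
  · obtain ⟨O, hO, hOU⟩ := hB.exists_isOpen_image_evalOn hl hF
      (IsOpen.preimage QuotientGroup.continuous_mk hU)
    refine isOpen_induced_iff.2 ⟨O, hO, ?_⟩
    ext q
    induction q using QuotientGroup.induction_on with | H x => ?_
    have : x ∈ evalOn B ⁻¹' O ↔ x ∈ evalOn B ⁻¹' (evalOn B '' (QuotientGroup.mk ⁻¹' U)) := by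
      rw [hOU]
    refine this.trans ⟨?_, fun h => ⟨x, h, rfl⟩⟩
    rintro ⟨y, hy, hyx⟩
    rw [← (hB.mk_eq_mk_iff hl).2 hyx]
    exact hy
  · convert hB.isClosed_range_evalOn hl hF using 1
    exact (QuotientGroup.mk_surjective.range_comp (hB.quotientEval hl)).symm

theorem IsSaturated.polishSpace_quotient (hB : IsSaturated F B) (hl : IsCanonicalLift F)
    (hF : Continuous F) (hc : B.Countable) : PolishSpace (G ⧸ hB.kernel hl) := by
  have := hc.to_subtype
  exact (hB.isClosedEmbedding_quotientEval hl hF).polishSpace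

/-- A continuous function that depends only on the values of the functions in a countable saturated
family `B` extends to the power of the real line. -/
theorem IsSaturated.exists_extension (hB : IsSaturated F B) (hl : IsCanonicalLift F)
    (hF : Continuous F) (hc : B.Countable) (f : C(G, ℝ))
    (hf : ∀ x y, evalOn B x = evalOn B y → f x = f y) :
    ∃ g : C(B → ℝ, ℝ), ∀ x, g (evalOn B x) = f x := by
  have := hc.to_subtype
  let f' : C(G ⧸ hB.kernel hl, ℝ) :=
    ⟨fun q => Quotient.liftOn' q f fun x y h => hf x y ((hB.mk_eq_mk_iff hl).1 (Quotient.sound' h)),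
      (QuotientGroup.isQuotientMap_mk _).continuous_iff.2 f.continuous⟩
  obtain ⟨g, hg⟩ := f'.exists_extension (hB.isClosedEmbedding_quotientEval hl hF)
  exact ⟨g, fun x => DFunLike.congr_fun hg (x : G ⧸ hB.kernel hl)⟩

/-- If a saturated family `B` separates points, every continuous function on `G` depends on the
values of countably many functions from `B`, in the sense of the lift. -/
theorem IsSaturated.exists_countable_subset_dependsOn (hB : IsSaturated F B)
    (hl : IsCanonicalLift F) (hF : Continuous F) (hinj : Function.Injective (evalOn B))
    (f : C(G, ℝ)) : ∃ C ⊆ B, C.Countable ∧ DependsOn (f ∘ F) C := by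
  classical
  obtain ⟨C, hC, hdep⟩ := (f.continuous.comp hF).exists_countable_dependsOn
  refine ⟨C ∩ B, Set.inter_subset_right, hC.mono Set.inter_subset_left, fun z z' h => ?_⟩
  -- `w` agrees with `z` on `C`, and with `z'` on `B`; the latter gives `F w = F z'` by injectivity.
  let w : C(G, ℝ) → IrrationalPair := fun φ => if φ ∈ C then z φ else z' φ
  have h1 : f (F z) = f (F w) := hdep fun φ hφ => (if_pos hφ).symm
  have h2 : F w = F z' := hinj (hB.evalOn_lift_eq hl fun φ hφ => by
    by_cases hφC : φ ∈ C
    · exact (if_pos hφC).trans (h φ ⟨hφC, hφ⟩)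
    · exact if_neg hφC)
  exact h1.trans (congrArg f h2)

end Spectrum

/-! ### Embedding families and C-embedding -/

/-- A space of infinite weight has an embedding family of real functions whose cardinality is the
weight. -/
theorem exists_embedding_family {X : Type u} [TopologicalSpace X] [T35Space X]
    (h : ℵ₀ ≤ topologicalWeight X) :
    ∃ (T : Type u) (φ : T → C(X, ℝ)), #T = topologicalWeight X ∧
      ∀ (x : X) (O : Set X), IsOpen O → x ∈ O →
        ∃ t, ∃ V : Set ℝ, V ∈ 𝓝 (φ t x) ∧ φ t ⁻¹' V ⊆ O := by
  obtain ⟨ℬ, hℬ, hcard⟩ : topologicalWeight X ∈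
      {κ | ∃ ℬ : Set (Set X), TopologicalSpace.IsTopologicalBasis ℬ ∧ #ℬ = κ} :=
    csInf_mem ⟨_, _, TopologicalSpace.isTopologicalBasis_opens, rfl⟩
  -- One function for each pair of basic sets that some function separates suffices, and an infinite
  -- base has as many pairs as members.
  have : ∀ t : ℬ × ℬ, ∃ φ : C(X, ℝ),
      (∃ ψ : C(X, ℝ), (∀ y ∈ t.1.1, ψ y < 1 / 2) ∧ ∀ y ∉ t.2.1, ψ y = 1) →
        (∀ y ∈ t.1.1, φ y < 1 / 2) ∧ ∀ y ∉ t.2.1, φ y = 1 := by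
    intro t
    by_cases ht : ∃ ψ : C(X, ℝ), (∀ y ∈ t.1.1, ψ y < 1 / 2) ∧ ∀ y ∉ t.2.1, ψ y = 1
    · exact ht.imp fun ψ hψ _ => hψ
    · exact ⟨0, fun h => absurd h ht⟩
  choose φ hφ using this
  refine ⟨ℬ × ℬ, φ, ?_, fun x O hO hx => ?_⟩
  · rw [← hcard] at h ⊢
    rw [Cardinal.mk_prod, Cardinal.lift_id, Cardinal.mul_eq_self h]
  · obtain ⟨V, hV, hxV, hVO⟩ := hℬ.exists_subset_of_mem_open hx hO
    obtain ⟨ψ, h0, h1⟩ := T35Space.exists_continuousMap (hℬ.isOpen hV) hxV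
    obtain ⟨U, hU, hxU, hUψ⟩ := hℬ.exists_subset_of_mem_open (a := x)
      (show x ∈ ψ ⁻¹' Set.Iio (1 / 2) by simp [h0]) (isOpen_Iio.preimage ψ.continuous)
    have := hφ (⟨U, hU⟩, ⟨V, hV⟩) ⟨ψ, fun y hy => hUψ hy, h1⟩
    refine ⟨_, Set.Iio (1 / 2), Iio_mem_nhds (this.1 x hxU), fun y hy => hVO ?_⟩
    by_contra hyV
    have hy' : φ (⟨U, hU⟩, ⟨V, hV⟩) y < 1 / 2 := hy
    rw [this.2 y hyV] at hy'
    norm_num at hy'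

theorem isCEmbedded_range_of_isEmbedding {X Y : Type u} [TopologicalSpace X] [TopologicalSpace Y]
    {j : X → Y} (hj : IsEmbedding j) (h : ∀ f : C(X, ℝ), ∃ g : C(Y, ℝ), ∀ x, g (j x) = f x) :
    IsCEmbedded (Set.range j) := by
  intro f
  obtain ⟨g, hg⟩ := h ⟨fun x => f ⟨j x, x, rfl⟩,
    f.continuous.comp (hj.continuous.subtype_mk fun x => ⟨x, rfl⟩)⟩
  refine ⟨g, ?_⟩
  ext ⟨_, x, rfl⟩
  exact hg x

/-! ### The diagonal embedding into a product of Polish groups -/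

section Product

variable {G T : Type u} [Group G] [TopologicalSpace G] {F : (C(G, ℝ) → IrrationalPair) → G}
  {B : T → Set C(G, ℝ)}

/-- The diagonal homomorphism into the product of the quotients given by saturated families. -/
def diagonalHom (hB : ∀ t, IsSaturated F (B t)) (hl : IsCanonicalLift F) :
    G →* ∀ t, G ⧸ (hB t).kernel hl := MonoidHom.pi fun t => QuotientGroup.mk' ((hB t).kernel hl)

variable (hB : ∀ t, IsSaturated F (B t)) (hl : IsCanonicalLift F)

theorem isClosedEmbedding_diagonalHom (hF : Continuous F)
    (hemb : IsEmbedding (evalOn (⋃ t, B t))) : IsClosedEmbedding (diagonalHom hB hl) := by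
  have hmem : ∀ φ : (⋃ t, B t), ∃ t, φ.1 ∈ B t := fun φ => Set.mem_iUnion.1 φ.2
  choose t ht using hmem
  let P : (∀ t, G ⧸ (hB t).kernel hl) → ((⋃ t, B t : Set C(G, ℝ)) → ℝ) :=
    fun y φ => (hB (t φ)).quotientEval hl (y (t φ)) ⟨φ.1, ht φ⟩
  have hP : Continuous P := continuous_pi fun φ => (continuous_apply _).comp
    (((hB (t φ)).isClosedEmbedding_quotientEval hl hF).continuous.comp (continuous_apply (t φ)))
  have hcont : Continuous (diagonalHom hB hl) :=
    continuous_pi fun t => QuotientGroup.continuous_mk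
  have hcomp : P ∘ diagonalHom hB hl = evalOn (⋃ t, B t) := rfl
  refine ⟨.of_comp hcont hP (hcomp ▸ hemb), ?_⟩
  -- A function may lie in several `B t` while `P` reads it at one chosen index; the equations force
  -- the other indices to agree.
  have hrange : Set.range (diagonalHom hB hl) = P ⁻¹' Set.range (evalOn (⋃ t, B t)) ∩
      ⋂ (t) (ψ : B t), {y | (hB t).quotientEval hl (y t) ψ =
        P y ⟨ψ.1, Set.mem_iUnion_of_mem t ψ.2⟩} := by
    refine Set.Subset.antisymm ?_ ?_
    · rintro _ ⟨x, rfl⟩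
      exact ⟨⟨x, rfl⟩, Set.mem_iInter₂.2 fun t ψ => rfl⟩
    · rintro y ⟨⟨x, hx⟩, hy⟩
      refine ⟨x, funext fun t => ((hB t).isClosedEmbedding_quotientEval hl hF).injective
        (funext fun ψ => Eq.trans ?_ (Set.mem_iInter₂.1 hy t ψ).symm)⟩
      exact congrFun hx ⟨ψ.1, Set.mem_iUnion_of_mem t ψ.2⟩
  rw [hrange]
  refine (((isSaturated_iUnion hB).isClosed_range_evalOn hl hF).preimage hP).inter
    (isClosed_iInter fun t => isClosed_iInter fun ψ => isClosed_eq ?_ ?_)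
  · exact (continuous_apply ψ).comp
      (((hB t).isClosedEmbedding_quotientEval hl hF).continuous.comp (continuous_apply t))
  · exact continuous_pi_iff.1 hP ⟨ψ.1, Set.mem_iUnion_of_mem t ψ.2⟩

/-- Choosing one family for each of the countably many functions that matter for `f` gives a
countable saturated union `D`. The extension to ℝ^D is composed with the map reading the values of
`D` off the product. -/
theorem exists_extension_diagonalHom (hF : Continuous F) (hc : ∀ t, (B t).Countable)
    (hinj : Function.Injective (evalOn (⋃ t, B t))) (f : C(G, ℝ)) :
    ∃ g : C(∀ t, G ⧸ (hB t).kernel hl, ℝ), ∀ x, g (diagonalHom hB hl x) = f x := by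
  obtain ⟨C, hCB, hC, hdep⟩ :=
    (isSaturated_iUnion hB).exists_countable_subset_dependsOn hl hF hinj f
  have hmem : ∀ φ : C, ∃ t, φ.1 ∈ B t := fun φ => Set.mem_iUnion.1 (hCB φ.2)
  choose s hs using hmem
  have := hC.to_subtype
  let D := ⋃ φ : C, B (s φ)
  have hD : IsSaturated F D := isSaturated_iUnion fun φ => hB (s φ)
  obtain ⟨g, hg⟩ := hD.exists_extension hl hF (Set.countable_iUnion fun φ => hc (s φ)) f
    fun x y hxy => by
      obtain ⟨z, w, rfl, rfl, hzw⟩ := hl.exists_agree hxy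
      exact hdep fun φ hφ => hzw φ (Set.mem_iUnion_of_mem ⟨φ, hφ⟩ (hs ⟨φ, hφ⟩))
  have hmem : ∀ φ : D, ∃ t, φ.1 ∈ B t := fun φ => (Set.mem_iUnion.1 φ.2).imp' s fun _ h => h
  choose t ht using hmem
  have hP : Continuous fun (y : ∀ t, G ⧸ (hB t).kernel hl) (φ : D) =>
      (hB (t φ)).quotientEval hl (y (t φ)) ⟨φ.1, ht φ⟩ :=
    continuous_pi fun φ => (continuous_apply _).comp
      (((hB (t φ)).isClosedEmbedding_quotientEval hl hF).continuous.comp (continuous_apply (t φ)))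
  exact ⟨g.comp ⟨_, hP⟩, hg⟩

end Product

theorem corollary3p3 (τ : Cardinal.{u}) (hτ : ℵ₀ ≤ τ)
    (G : Type u) [Group G] [TopologicalSpace G] [IsTopologicalGroup G] [T35Space G]
    (hG : IsAbsoluteExtensor 0 G) (hw : topologicalWeight G = τ) :
    ∃ (T : Type u) (H : T → Type u) (_ : ∀ t, Group (H t)) (_ : ∀ t, TopologicalSpace (H t))
      (_ : ∀ t, IsTopologicalGroup (H t)) (_ : ∀ t, PolishSpace (H t)),
      #T = τ ∧
      ∃ K : Subgroup (∀ t, H t),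
        IsClosed (K : Set (∀ t, H t)) ∧ IsCEmbedded (K : Set (∀ t, H t)) ∧
          Nonempty (G ≃ₜ* K) := by
  obtain ⟨F, hl⟩ := hG.exists_isCanonicalLift
  obtain ⟨T, φ, hT, hφ⟩ := exists_embedding_family (hw ▸ hτ)
  choose B hc hφB hB using fun t => exists_countable_isSaturated F.continuous (φ t)
  have hemb : IsEmbedding (evalOn (⋃ t, B t)) := isEmbedding_evalOn fun x O hO hx => by
    obtain ⟨t, h⟩ := hφ x O hO hx
    exact ⟨φ t, Set.mem_iUnion_of_mem t (hφB t), h⟩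
  have hd := isClosedEmbedding_diagonalHom hB hl F.continuous hemb
  refine ⟨T, fun t => G ⧸ (hB t).kernel hl, inferInstance, inferInstance, inferInstance,
    fun t => (hB t).polishSpace_quotient hl F.continuous (hc t), hT.trans hw,
    (diagonalHom hB hl).range, ?_, ?_, ⟨?_⟩⟩
  · simpa using hd.isClosed_range
  · rw [MonoidHom.coe_range]
    exact isCEmbedded_range_of_isEmbedding hd.isEmbedding
      (exists_extension_diagonalHom hB hl F.continuous hc hemb.injective)
  · let e := MonoidHom.ofInjective hd.injective
    exact { e with
      continuous_toFun := hd.continuous.subtype_mk _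
      continuous_invFun := by
        rw [hd.isEmbedding.isInducing.continuous_iff]
        exact continuous_subtype_val.congr fun k =>
          (congrArg Subtype.val (e.apply_symm_apply k)).symm }
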